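/- Let $K$ be a number field with algebraic closure $\overline K$, let $T$ be a finite set of places of $K$ (finite or infinite), and let $G$ be a finite group with a normal series \[ \{1\}=G_0\le G_1\le\cdots\le G_m=G,\qquad G_i\trianglelefteq G . \] For a number field $L\subset\overline K$ and a set $T'$ of places of $L$, let $G_L^{T'}$ denote the Galois group over $L$ of the maximal extension of $L$ in $\overline K$ unramified outside $T'$ (a real place outside $T'$ has to stay real), let $\mathrm{Hom}(G_L^{T'},A)$ be the set of continuous homomorphisms to a finite discrete group $A$, and for $L\supseteq K$ let $T(L)$ be the set of places of $L$ lying above a place in $T$. Then $\mathrm{Hom}(G_K^T,G)$ is finite, and there are finite Galois extensions $L_{i,T}/K$ in $\overline K$, $i=1,\dots,m$, unramified outside $T$, with $L_{m,T}=K$ (if $m\ge 1$), such that for every $i$ there is an injective homomorphism \[ \mathrm{Gal}(L_{i,T}/K)\hookrightarrow (G/G_{i-1})/C_G(G_i/G_{i-1}), \] where $C_G(G_i/G_{i-1})$ is the centralizer of $G_i/G_{i-1}$ in $G/G_{i-1}$, each set $\mathrm{Hom}\big(G_{L_{i,T}}^{T(L_{i,T})},G_i/G_{i-1}\big)$ is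 finite, and \[ |\mathrm{Hom}(G_K^T,G)|\le\prod_{i=1}^m|\mathrm{Gal}(L_{i,T}/K)|^{|G/G_{i-1}|}\cdot\big|\mathrm{Hom}\big(G_{L_{i,T}}^{T(L_{i,T})},G_i/G_{i-1}\big)\big| . \] -/

import Mathlib

open NumberField IsDedekindDomain

/-- The places of a number field `K`: the nonzero primes of its ring of integers (finite places)
together with the infinite places. -/
abbrev NFPlace (K : Type*) [Field K] : Type _ :=
  HeightOneSpectrum (𝓞 K) ⊕ InfinitePlace K

/-- `PlaceAbove K L w v`: the place `w` of `L` lies above the place `v` of `K`. -/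
def PlaceAbove (K L : Type*) [Field K] [Field L] [Algebra K L] : NFPlace L → NFPlace K → Prop
  | Sum.inl w, Sum.inl v => w.asIdeal.LiesOver v.asIdeal
  | Sum.inr w, Sum.inr v => w.comap (algebraMap K L) = v
  | _, _ => False

/-- `T(L)`: the set of places of `L` lying above a place in `T`. -/
def placesAbove {K : Type*} [Field K] (T : Set (NFPlace K)) (L : Type*) [Field L] [Algebra K L] :
    Set (NFPlace L) :=
  {w | ∃ v ∈ T, PlaceAbove K L w v}

/-- The extension `L/K` of number fields is unramified outside `T`. A real place of `K` is
unramified in `L` when all the places of `L` above it are real. -/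
def UnramifiedOutside (K L : Type*) [Field K] [Field L] [Algebra K L] (T : Set (NFPlace K)) :
    Prop :=
  (∀ v : HeightOneSpectrum (𝓞 K), Sum.inl v ∉ T → Algebra.IsUnramifiedIn (𝓞 L) v.asIdeal) ∧
  (∀ v : InfinitePlace K, Sum.inr v ∉ T → v.IsUnramifiedIn L)

/-- The maximal extension of `K` inside `Ω` (an algebraic closure of `K`) that is unramified
outside `T`: the compositum of all finite subextensions unramified outside `T`. -/
def maxUnramifiedOutside (K Ω : Type*) [Field K] [Field Ω] [Algebra K Ω] (T : Set (NFPlace K)) :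
    IntermediateField K Ω :=
  sSup {F : IntermediateField K Ω | FiniteDimensional K F ∧ UnramifiedOutside K F T}

/-- `G_K^T`: the Galois group of the maximal extension of `K` unramified outside `T`; it carries
the Krull topology. -/
abbrev GaloisGroupOutside (K Ω : Type*) [Field K] [Field Ω] [Algebra K Ω]
    (T : Set (NFPlace K)) : Type _ :=
  Gal(maxUnramifiedOutside K Ω T/K)

/-- Continuous homomorphisms from a topological group `H` to a group `A` with the discrete
topology. -/
abbrev DiscreteHom (H A : Type*) [Group H] [TopologicalSpace H] [Group A] : Type _ :=
  @ContinuousMonoidHom H A _ _ _ (⊥ : TopologicalSpace A)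

/-- A normal series `1 = G₀ ≤ G₁ ≤ ⋯ ≤ G_m = G` with every `G_i` normal in `G`. -/
structure NormalSeries (G : Type*) [Group G] (m : ℕ) where
  /-- The terms `G_0, …, G_m`. -/
  term : Fin (m + 1) → Subgroup G
  mono : Monotone term
  normal : ∀ i, (term i).Normal
  term_zero : term 0 = ⊥
  term_last : term (Fin.last m) = ⊤

namespace NormalSeries

variable {G : Type*} [Group G] {m : ℕ} (S : NormalSeries G m)

instance (i : Fin (m + 1)) : (S.term i).Normal := S.normal i

/-! The index `i : Fin m` below stands for the usual index `i + 1 ∈ {1, …, m}`. -/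

/-- The quotient `G/G_{i-1}`. -/
abbrev Quot (i : Fin m) : Type _ := G ⧸ S.term i.castSucc

/-- The factor `G_i/G_{i-1}`, as a subgroup of `G/G_{i-1}`. -/
def factor (i : Fin m) : Subgroup (S.Quot i) :=
  (S.term i.succ).map (QuotientGroup.mk' (S.term i.castSucc))

instance (i : Fin m) : (S.factor i).Normal :=
  Subgroup.Normal.map (S.normal i.succ) _ (QuotientGroup.mk'_surjective _)

/-- The group `(G/G_{i-1})/C_G(G_i/G_{i-1})`, the centralizer being that of `G_i/G_{i-1}` in
`G/G_{i-1}`. -/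
abbrev ActingQuot (i : Fin m) : Type _ :=
  S.Quot i ⧸ Subgroup.centralizer (S.factor i : Set (S.Quot i))

end NormalSeries

/-!
The homomorphisms to `G` are counted one step `G/G_{i-1} → G/G_i` of the series at a time. Among
the unramified homomorphisms to `B = G/G_{i-1}` choose `φ₀` whose fibre over `G/G_i` is largest, and
let `L` be the field cut out by the conjugation action of `φ₀` on `A = G_i/G_{i-1}`. For `φ` in the
fibre of `φ₀`, the map `φ φ₀⁻¹` is a homomorphism from the Galois group of `L` to `A`, and `φ` is
determined by it together with `[L : K] - 1` elements of `A`, the values of `φ φ₀⁻¹` at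
representatives of the nontrivial cosets. The inequality `b ^ (g - 1) ≤ g ^ b` for `1 ≤ g ≤ b` turns
the resulting bound into the asserted one. At the last step the fibre is everything, so `φ₀ = 1`
will do and `L = K`.

Finiteness is the theorem of Hermite and Minkowski, given a bound on the discriminant. The
different of a Galois extension `L/K` is Galois invariant, and if it is divisible by the extension
of an ideal `I` of `𝓞 K`, then taking traces shows `[L : K] ∈ I`. Together these bound the
exponents of the primes in the different in terms of `[L : K]` alone.
-/

section Inertia

theorem card_subgroupOf_mul_relIndex {G : Type*} [Group G] (H I : Subgroup G) :
    Nat.card (I.subgroupOf H) * H.relIndex I = Nat.card I := by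
  rw [← Subgroup.inf_subgroupOf_left,
    Nat.card_congr (Subgroup.subgroupOfEquivOfLe inf_le_left).toEquiv, ← Subgroup.relIndex_bot_left,
    Subgroup.relIndex_inf_mul_relIndex, bot_inf_eq, Subgroup.relIndex_bot_left]

theorem card_inertia_eq_ramificationIdx {A C G : Type*} [CommRing A] [IsDomain A] [CommRing C]
    [IsDomain C] [Algebra A C] [Module.Finite A C] [Module.Flat A C] [Group G] [Finite G]
    [MulSemiringAction G C] [IsGaloisGroup G A C] (Q : Ideal C) [Q.IsPrime]
    [PerfectField (Q.under A).ResidueField] :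
    Nat.card (Q.inertia G) = Q.ramificationIdx A := by
  rw [Ideal.card_inertia_eq_ramificationIdxIn (Q.under A) Q,
    Ideal.ramificationIdxIn_eq_ramificationIdx (Q.under A) Q G]

theorem mult_eq_card_stabilizer_mul_mult_comap {K N : Type*} [Field K] [Field N] [Algebra K N]
    [IsGalois K N] (w : InfinitePlace N) :
    w.mult = Nat.card (MulAction.stabilizer Gal(N/K) w) * (w.comap (algebraMap K N)).mult := by
  classical
  rw [InfinitePlace.card_stabilizer]
  split_ifs with h
  · rw [one_mul, h.eq]
  · rw [(InfinitePlace.IsRamified.isComplex h).mult_eq_two,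
      (InfinitePlace.IsRamified.isReal h).mult_eq_one]

theorem mult_comap_eq_relIndex_stabilizer_mul_mult_comap {K N : Type*} [Field K] [Field N]
    [Algebra K N] [IsGalois K N] [FiniteDimensional K N] (F : IntermediateField K N)
    (w : InfinitePlace N) :
    (w.comap (algebraMap F N)).mult =
      F.fixingSubgroup.relIndex (MulAction.stabilizer Gal(N/K) w) *
        (w.comap (algebraMap K N)).mult := by
  have hF : Nat.card (MulAction.stabilizer Gal(N/F) w) =
      Nat.card ((MulAction.stabilizer Gal(N/K) w).subgroupOf F.fixingSubgroup) :=
    Nat.card_congr (F.fixingSubgroupEquiv.toEquiv.subtypeEquiv fun _ ↦ Iff.rfl).symm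
  refine Nat.eq_of_mul_eq_mul_left (Nat.card_pos (α := MulAction.stabilizer Gal(N/F) w)) ?_
  rw [← mult_eq_card_stabilizer_mul_mult_comap, hF, ← mul_assoc, card_subgroupOf_mul_relIndex,
    ← mult_eq_card_stabilizer_mul_mult_comap]

theorem ramificationIdx_under_eq_relIndex_inertia {A B C G : Type*} [CommRing A] [IsDomain A]
    [CommRing B] [IsDomain B] [CommRing C] [IsDomain C] [Algebra A B] [Algebra B C] [Algebra A C]
    [IsScalarTower A B C] [Module.Finite A C] [Module.Finite B C] [Module.Flat A C]
    [Module.Flat B C] [Group G] [Finite G] [MulSemiringAction G C] [IsGaloisGroup G A C]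
    (H : Subgroup G) [IsGaloisGroup H B C] (Q : Ideal C) [Q.IsPrime]
    [PerfectField (Q.under A).ResidueField] [PerfectField (Q.under B).ResidueField] :
    (Q.under B).ramificationIdx A = H.relIndex (Q.inertia G) := by
  refine Nat.eq_of_mul_eq_mul_right (Nat.card_pos (α := Q.inertia H)) ?_
  rw [card_inertia_eq_ramificationIdx (A := B), ← Ideal.ramificationIdx_tower,
    ← card_inertia_eq_ramificationIdx (G := G), ← card_subgroupOf_mul_relIndex H, mul_comm,
    ← card_inertia_eq_ramificationIdx (G := H)]
  rfl

end Inertia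

section Places

variable {K F L : Type*} [Field K] [Field F] [Field L] [Algebra K F] [Algebra F L] [Algebra K L]
  [IsScalarTower K F L] {T : Set (NFPlace K)}

namespace NFPlace

variable (K) in
/-- The place of `K` below a place of the extension `L`. -/
def under : NFPlace L → NFPlace K :=
  Sum.map (HeightOneSpectrum.under (𝓞 K)) (·.comap (algebraMap K L))

variable (K) in
/-- A place of `L` is unramified over `K`; for infinite places this means that a real place does
not become complex. -/
def IsUnramified : NFPlace L → Prop
  | .inl Q => Algebra.IsUnramifiedAt (𝓞 K) Q.asIdeal
  | .inr w => w.IsUnramified K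

variable (K) in
/-- The inertia group of a place of `L`; for an infinite place it is the decomposition group. -/
def inertia : NFPlace L → Subgroup Gal(L/K)
  | .inl Q => Q.asIdeal.inertia Gal(L/K)
  | .inr w => MulAction.stabilizer Gal(L/K) w

theorem under_under (w : NFPlace L) : under K (under F w) = under K w := by
  rcases w with Q | w
  · exact congrArg Sum.inl (HeightOneSpectrum.ext (Ideal.under_under Q.asIdeal))
  · refine congrArg Sum.inr ?_
    change (w.comap (algebraMap F L)).comap (algebraMap K F) = w.comap (algebraMap K L)
    rw [← InfinitePlace.comap_comp, ← IsScalarTower.algebraMap_eq]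

theorem placeAbove_iff {w : NFPlace L} {v : NFPlace K} : PlaceAbove K L w v ↔ under K w = v := by
  rcases w with Q | w <;> rcases v with p | v
  · simp [PlaceAbove, under, HeightOneSpectrum.ext_iff, Ideal.liesOver_iff, eq_comm]
  all_goals simp [PlaceAbove, under]

theorem placesAbove_eq_preimage : placesAbove T L = under K ⁻¹' T := by
  ext w
  simp [placesAbove, placeAbove_iff]

theorem unramifiedOutside_iff :
    UnramifiedOutside K L T ↔ ∀ w : NFPlace L, under K w ∉ T → IsUnramified K w := by
  simp only [UnramifiedOutside, Sum.forall]
  refine and_congr ⟨fun h Q hQ ↦ h _ hQ _ Q.isPrime ⟨rfl⟩, fun h v hv Q hQp hQ ↦ ?_⟩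
    ⟨fun h w hw ↦ h _ hw w rfl, fun h v hv w hw ↦ h w ?_⟩
  · let Q' : HeightOneSpectrum (𝓞 L) := ⟨Q, hQp, Ideal.ne_bot_of_liesOver_of_ne_bot v.ne_bot Q⟩
    have hQ' : under K (Sum.inl Q') = Sum.inl v := placeAbove_iff.1 hQ
    exact h Q' (hQ' ▸ hv)
  · have hw' : under K (Sum.inr w) = Sum.inr v := placeAbove_iff.1 hw
    exact hw' ▸ hv

theorem IsUnramified.tower_top {w : NFPlace L} (h : IsUnramified K w) : IsUnramified F w := by
  rcases w with Q | w
  · have : Algebra.IsUnramifiedAt (𝓞 K) Q.asIdeal := h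
    exact Algebra.IsUnramifiedAt.of_restrictScalars (𝓞 K) Q.asIdeal
  · exact InfinitePlace.IsUnramified.of_restrictScalars F h

variable [NumberField F] [NumberField L]

theorem under_surjective : Function.Surjective (under F : NFPlace L → NFPlace F) := by
  rintro (q | v)
  · obtain ⟨Q, _, hQ⟩ : Nonempty (q.asIdeal.primesOver (𝓞 L)) := inferInstance
    let Q' : HeightOneSpectrum (𝓞 L) := ⟨Q, ‹_›, Ideal.ne_bot_of_liesOver_of_ne_bot q.ne_bot Q⟩
    exact ⟨Sum.inl Q', placeAbove_iff.1 hQ⟩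
  · obtain ⟨w, rfl⟩ := InfinitePlace.comap_surjective (k := F) (K := L) v
    exact ⟨Sum.inr w, rfl⟩

theorem finite_placesAbove {T : Set (NFPlace F)} (hT : T.Finite) : (placesAbove T L).Finite := by
  rw [placesAbove_eq_preimage]
  refine hT.preimage' ?_
  rintro (v | v) -
  · have hfin := IsDedekindDomain.primesOver_finite v.asIdeal (𝓞 L)
    refine ((hfin.preimage fun Q _ Q' _ h ↦ HeightOneSpectrum.ext h).image Sum.inl).subset ?_
    rintro (Q | w) hQ
    · exact ⟨Q, ⟨Q.isPrime, placeAbove_iff.2 hQ⟩, rfl⟩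
    · exact (placeAbove_iff.2 hQ).elim
  · refine (Set.finite_range (Sum.inr : InfinitePlace L → NFPlace L)).subset ?_
    rintro (Q | w) hw
    · exact (placeAbove_iff.2 hw).elim
    · exact ⟨w, rfl⟩

theorem IsUnramified.under [NumberField K] {w : NFPlace L}
    (h : IsUnramified K w) : IsUnramified K (under F w) := by
  rcases w with Q | w
  · have : Algebra.IsUnramifiedAt (𝓞 K) Q.asIdeal := h
    exact Algebra.IsUnramifiedAt.of_liesOver (𝓞 K) (Q.asIdeal.under (𝓞 F)) Q.asIdeal
  · exact InfinitePlace.IsUnramified.comap F h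

theorem isUnramified_under_iff_inertia_le [NumberField K] [IsGalois K L]
    {E : IntermediateField K L} {w : NFPlace L} :
    IsUnramified K (NFPlace.under E w) ↔ inertia K w ≤ E.fixingSubgroup := by
  rw [← Subgroup.relIndex_eq_one]
  rcases w with Q | w
  · have : IsGaloisGroup E.fixingSubgroup E L := .intermediateField Gal(L/K) K L E
    have : IsGaloisGroup E.fixingSubgroup (𝓞 E) (𝓞 L) :=
      .of_isFractionRing E.fixingSubgroup (𝓞 E) (𝓞 L) E L
    rw [inertia, ← ramificationIdx_under_eq_relIndex_inertia (A := 𝓞 K) (B := 𝓞 E),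
      Ideal.ramificationIdx_eq_one_iff]
    rfl
  · change (w.comap (algebraMap E L)).IsUnramified K ↔
      E.fixingSubgroup.relIndex (MulAction.stabilizer Gal(L/K) w) = 1
    rw [InfinitePlace.IsUnramified, mult_comap_eq_relIndex_stabilizer_mul_mult_comap,
      ← InfinitePlace.comap_comp, ← IsScalarTower.algebraMap_eq, eq_comm,
      Nat.mul_eq_right InfinitePlace.mult_ne_zero]

end NFPlace

namespace UnramifiedOutside

variable (K T) in
protected theorem self : UnramifiedOutside K K T := by
  refine ⟨fun v _ q _ _ ↦ ?_, fun v _ w _ ↦ w.isUnramified_self⟩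
  exact inferInstanceAs (Algebra.FormallyUnramified (𝓞 K) (Localization.AtPrime q))

variable (F) in
theorem tower_top (h : UnramifiedOutside K L T) : UnramifiedOutside F L (placesAbove T F) := by
  rw [NFPlace.placesAbove_eq_preimage, NFPlace.unramifiedOutside_iff]
  intro w hw
  refine (NFPlace.unramifiedOutside_iff.1 h w ?_).tower_top
  rwa [← NFPlace.under_under (F := F)]

variable [NumberField K] [NumberField F] [NumberField L]

theorem tower_bot (h : UnramifiedOutside K L T) : UnramifiedOutside K F T := by
  rw [NFPlace.unramifiedOutside_iff]
  intro u hu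
  obtain ⟨w, rfl⟩ := NFPlace.under_surjective (L := L) u
  rw [NFPlace.under_under] at hu
  exact (NFPlace.unramifiedOutside_iff.1 h w hu).under

omit [Algebra F L] [IsScalarTower K F L] in
theorem of_algHom (h : UnramifiedOutside K L T) (f : F →ₐ[K] L) : UnramifiedOutside K F T := by
  let _ : Algebra F L := f.toAlgebra
  have : IsScalarTower K F L := .of_algebraMap_eq' f.comp_algebraMap.symm
  exact h.tower_bot

end UnramifiedOutside

theorem unramifiedOutside_iff_inertia_le [NumberField K] [NumberField L] [IsGalois K L]
    {E : IntermediateField K L} : UnramifiedOutside K E T ↔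
      ∀ w : NFPlace L, w.under K ∉ T → w.inertia K ≤ E.fixingSubgroup := by
  have hsurj : Function.Surjective (NFPlace.under E : NFPlace L → NFPlace E) :=
    NFPlace.under_surjective
  rw [NFPlace.unramifiedOutside_iff, hsurj.forall]
  simp only [NFPlace.under_under, NFPlace.isUnramified_under_iff_inertia_le]

end Places

section Compositum

variable {K Ω : Type*} [Field K] [NumberField K] [Field Ω] [Algebra K Ω] {T : Set (NFPlace K)}
  {E E₁ E₂ : IntermediateField K Ω}

namespace UnramifiedOutside

variable (K Ω T) in
protected theorem bot : UnramifiedOutside K (⊥ : IntermediateField K Ω) T :=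
  have := NumberField.of_module_finite K (⊥ : IntermediateField K Ω)
  (UnramifiedOutside.self K T).of_algHom (IntermediateField.botEquiv K Ω).toAlgHom

theorem of_le [FiniteDimensional K E₂] (h : UnramifiedOutside K E₂ T) (hle : E₁ ≤ E₂) :
    UnramifiedOutside K E₁ T := by
  have : FiniteDimensional K E₁ := .of_injective (IntermediateField.inclusion hle).toLinearMap
    (IntermediateField.inclusion_injective hle)
  have := NumberField.of_module_finite K E₁
  have := NumberField.of_module_finite K E₂
  exact h.of_algHom (IntermediateField.inclusion hle)

protected theorem map {Ω' : Type*} [Field Ω'] [Algebra K Ω'] [FiniteDimensional K E]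
    (h : UnramifiedOutside K E T) (σ : Ω →ₐ[K] Ω') :
    UnramifiedOutside K (E.map σ) T := by
  have : FiniteDimensional K (E.map σ) := (E.equivMap σ).toLinearEquiv.finiteDimensional
  have := NumberField.of_module_finite K E
  have := NumberField.of_module_finite K (E.map σ)
  exact h.of_algHom (E.equivMap σ).symm.toAlgHom

theorem sup_of_isGalois [FiniteDimensional K Ω] [IsGalois K Ω] (h₁ : UnramifiedOutside K E₁ T)
    (h₂ : UnramifiedOutside K E₂ T) : UnramifiedOutside K ↥(E₁ ⊔ E₂) T := by
  have := NumberField.of_module_finite K Ω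
  rw [unramifiedOutside_iff_inertia_le] at *
  intro w hw
  rw [IntermediateField.fixingSubgroup_sup]
  exact le_inf (h₁ w hw) (h₂ w hw)

protected theorem sup [Normal K Ω] [FiniteDimensional K E₁] [FiniteDimensional K E₂]
    (h₁ : UnramifiedOutside K E₁ T) (h₂ : UnramifiedOutside K E₂ T) :
    UnramifiedOutside K ↥(E₁ ⊔ E₂) T := by
  let N : IntermediateField K Ω := IntermediateField.normalClosure K ↥(E₁ ⊔ E₂) Ω
  have : IsGalois K N := ⟨⟩
  have hN : E₁ ⊔ E₂ ≤ N := IntermediateField.le_normalClosure _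
  have hN₁ : E₁ ≤ N := le_sup_left.trans hN
  have hN₂ : E₂ ≤ N := le_sup_right.trans hN
  have := NumberField.of_module_finite K E₁
  have := NumberField.of_module_finite K E₂
  have := NumberField.of_module_finite K N
  have h₁' : UnramifiedOutside K (IntermediateField.restrict hN₁) T :=
    h₁.of_algHom (IntermediateField.restrictAlgEquiv hN₁).symm.toAlgHom
  have h₂' : UnramifiedOutside K (IntermediateField.restrict hN₂) T :=
    h₂.of_algHom (IntermediateField.restrictAlgEquiv hN₂).symm.toAlgHom
  have hsup : IntermediateField.map N.val (.restrict hN₁ ⊔ .restrict hN₂) = E₁ ⊔ E₂ := by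
    rw [IntermediateField.map_sup]
    exact congrArg₂ (· ⊔ ·) (IntermediateField.lift_restrict hN₁)
      (IntermediateField.lift_restrict hN₂)
  exact hsup ▸ (h₁'.sup_of_isGalois h₂').map N.val

end UnramifiedOutside

theorem le_maxUnramifiedOutside_iff [Normal K Ω] [FiniteDimensional K E] :
    E ≤ maxUnramifiedOutside K Ω T ↔ UnramifiedOutside K E T := by
  refine ⟨fun hE ↦ ?_, fun h ↦ le_sSup ⟨inferInstance, h⟩⟩
  let 𝓕 := {F : IntermediateField K Ω | FiniteDimensional K F ∧ UnramifiedOutside K F T}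
  have hbot : ⊥ ∈ 𝓕 := ⟨inferInstance, .bot K Ω T⟩
  have hdir : DirectedOn (· ≤ ·) 𝓕 := by
    rintro F₁ ⟨_, h₁⟩ F₂ ⟨_, h₂⟩
    exact ⟨F₁ ⊔ F₂, ⟨inferInstance, h₁.sup h₂⟩, le_sup_left, le_sup_right⟩
  obtain ⟨S, rfl⟩ : E.FG := IntermediateField.essFiniteType_iff.1 inferInstance
  obtain ⟨F, ⟨_, hF⟩, hle⟩ := (CompleteLattice.isCompactElement_iff_le_of_directed_sSup_le _ _).1
    (IntermediateField.adjoin_finset_isCompactElement S) _ ⟨_, hbot⟩ hdir hE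
  exact hF.of_le hle

instance [Normal K Ω] : Normal K (maxUnramifiedOutside K Ω T) := by
  rw [IntermediateField.normal_iff_forall_map_le]
  intro σ
  rw [IntermediateField.map_le_iff_le_comap]
  refine sSup_le fun E ⟨_, hE⟩ ↦ ?_
  rw [← IntermediateField.map_le_iff_le_comap]
  have : FiniteDimensional K (E.map σ) := (E.equivMap σ).toLinearEquiv.finiteDimensional
  exact le_maxUnramifiedOutside_iff.2 (hE.map σ)

end Compositum

section Different

open scoped nonZeroDivisors Pointwise

theorem exists_notMem_pow {R : Type*} [CommRing R] [IsDomain R] [IsNoetherianRing R] {I : Ideal R}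
    (hI : I ≠ ⊤) {x : R} (hx : x ≠ 0) : ∃ k, x ∉ I ^ k := by
  by_contra! h
  have : x ∈ ⨅ i, I ^ i := by simpa only [Ideal.mem_iInf] using h
  rw [Ideal.iInf_pow_eq_bot_of_isDomain _ hI] at this
  exact hx this

theorem smul_map_algebraMap {A B G : Type*} [CommRing A] [CommRing B] [Algebra A B] [Group G]
    [MulSemiringAction G B] [SMulCommClass G A B] (σ : G) (I : Ideal A) :
    σ • I.map (algebraMap A B) = I.map (algebraMap A B) := by
  rw [Ideal.pointwise_smul_def, Ideal.map_map]
  exact congrArg I.map (MulSemiringAction.toAlgHom A B σ).comp_algebraMap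

theorem emultiplicity_eq_of_smul_eq {A B G : Type*} [CommRing A] [CommRing B] [Algebra A B]
    [Group G] [Finite G] [MulSemiringAction G B] [IsGaloisGroup G A B] (p : Ideal A)
    {I P Q : Ideal B} [P.IsPrime] [Q.IsPrime] [P.LiesOver p] [Q.LiesOver p]
    (hI : ∀ σ : G, σ • I = I) : emultiplicity P I = emultiplicity Q I := by
  obtain ⟨σ, rfl⟩ := Ideal.exists_smul_eq_of_isGaloisGroup p P Q G
  conv_rhs => rw [← hI σ]
  exact (emultiplicity_map_eq (MulDistribMulAction.toMulEquiv (Ideal B) σ)).symm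

theorem mem_differentIdeal_iff {A B : Type*} (K L : Type*) [CommRing A] [IsDomain A]
    [IsIntegrallyClosed A] [CommRing B] [IsDedekindDomain B] [Algebra A B]
    [Module.IsTorsionFree A B] [Field K] [Field L] [Algebra A K] [IsFractionRing A K] [Algebra B L]
    [IsFractionRing B L] [Algebra K L] [Algebra A L] [IsScalarTower A K L] [IsScalarTower A B L]
    [FiniteDimensional K L] [Algebra.IsSeparable K L] [IsIntegralClosure B A L] {x : B} :
    x ∈ differentIdeal A B ↔ ∀ y : L,
      (∀ b : B, Algebra.trace K L (y * algebraMap B L b) ∈ (algebraMap A K).range) →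
        ∃ c : B, algebraMap B L c = algebraMap B L x * y := by
  have hx : x ∈ differentIdeal A B ↔
      algebraMap B L x ∈ IsLocalization.coeSubmodule L (differentIdeal A B) := by
    rw [IsLocalization.mem_coeSubmodule]
    exact ⟨fun h ↦ ⟨x, h, rfl⟩, fun ⟨y, hy, hyx⟩ ↦ IsFractionRing.injective B L hyx ▸ hy⟩
  rw [hx, coeSubmodule_differentIdeal A K, Submodule.mem_div_iff_forall_mul_mem]
  simp only [Submodule.mem_traceDual, Submodule.mem_one, forall_exists_index,
    forall_apply_eq_imp_iff, Algebra.traceForm_apply]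

variable {A B : Type*} [CommRing A] [IsDedekindDomain A] [CommRing B] [IsDedekindDomain B]
  [Algebra A B] [Module.IsTorsionFree A B] [Module.Finite A B]

attribute [local instance] FractionRing.liftAlgebra

variable [Algebra.IsSeparable (FractionRing A) (FractionRing B)]

theorem map_mem_differentIdeal (f : B ≃ₐ[A] B) {x : B} (hx : x ∈ differentIdeal A B) :
    f x ∈ differentIdeal A B := by
  let K := FractionRing A
  let L := FractionRing B
  rw [mem_differentIdeal_iff K L] at hx ⊢
  intro y hy
  let φ : L ≃ₐ[K] L := IsFractionRing.fieldEquivOfAlgEquiv K L L f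
  have hφ : ∀ b : B, φ (algebraMap B L b) = algebraMap B L (f b) :=
    IsFractionRing.fieldEquivOfAlgEquiv_algebraMap K L L f
  obtain ⟨c, hc⟩ := hx (φ.symm y) fun b ↦ by
    have := hy (f b)
    rwa [← Algebra.trace_eq_of_algEquiv φ.symm, map_mul, ← hφ, φ.symm_apply_apply] at this
  exact ⟨f c, by rw [← hφ, hc, map_mul, hφ, φ.apply_symm_apply]⟩

theorem smul_differentIdeal {G : Type*} [Group G] [MulSemiringAction G B] [SMulCommClass G A B]
    (σ : G) : σ • differentIdeal A B = differentIdeal A B := by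
  have hle : ∀ τ : G, differentIdeal A B ≤ τ • differentIdeal A B := fun τ x hx ↦
    Ideal.mem_pointwise_smul_iff_inv_smul_mem.2
      (map_mem_differentIdeal (MulSemiringAction.toAlgEquiv A B τ⁻¹) hx)
  refine le_antisymm ?_ (hle σ)
  simpa using! Ideal.pointwise_smul_le_pointwise_smul_iff (a := σ) |>.2 (hle σ⁻¹)

/-- If `I` divides the different, the elements of `I⁻¹ B` have integral traces; an element of `I⁻¹`
has its multiple by the degree as trace. -/
theorem finrank_mem_of_map_dvd_differentIdeal {I : Ideal A} (hI : I ≠ ⊥)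
    (h : I.map (algebraMap A B) ∣ differentIdeal A B) : (Module.finrank A B : A) ∈ I := by
  let K := FractionRing A
  let L := FractionRing B
  have : FiniteDimensional K L := Module.Finite.of_isLocalization A B A⁰
  have hI' : I.map (algebraMap A B) ≠ ⊥ := by
    rwa [Ne, Ideal.map_eq_bot_iff_of_injective (FaithfulSMul.algebraMap_injective _ _)]
  rw [Ideal.dvd_iff_le, differentialIdeal_le_iff (K := K) (L := L) hI',
    ← FractionalIdeal.extendedHom_coeIdeal_eq_map L B (K := K), ← map_inv₀] at h
  have hI₀ : (I : FractionalIdeal A⁰ K) ≠ 0 := FractionalIdeal.coeIdeal_ne_zero.2 hI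
  have hle : FractionalIdeal.spanSingleton A⁰ (Module.finrank A B : K) ≤ I := by
    rw [← div_le_one₀ (bot_lt_iff_ne_bot.2 hI₀), div_eq_mul_inv,
      FractionalIdeal.spanSingleton_mul_le_iff]
    intro z hz
    have hzL : algebraMap K L z ∈ FractionalIdeal.extendedHom L B (I : FractionalIdeal A⁰ K)⁻¹ := by
      rw [← FractionalIdeal.mem_coe, FractionalIdeal.coe_extendedHom_eq_span]
      exact Submodule.subset_span ⟨z, hz, rfl⟩
    rw [FractionalIdeal.mem_one_iff]
    have := Submodule.mem_one.1 (h ⟨_, hzL, rfl⟩)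
    rwa [LinearMap.restrictScalars_apply, Algebra.trace_algebraMap, nsmul_eq_mul,
      IsFractionRing.finrank_eq A K B L] at this
  rw [FractionalIdeal.spanSingleton_le_iff_mem, FractionalIdeal.mem_coeIdeal] at hle
  obtain ⟨x, hx, hxn⟩ := hle
  rw [← map_natCast (algebraMap A K)] at hxn
  exact IsFractionRing.injective A K hxn ▸ hx

theorem emultiplicity_differentIdeal_le (G : Type*) [Group G] [Finite G] [MulSemiringAction G B]
    [IsGaloisGroup G A B] {p : Ideal A} [p.IsPrime] (hp : p ≠ ⊥) {k : ℕ}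
    (hk : (Module.finrank A B : A) ∉ p ^ k) (Q : Ideal B) [Q.IsPrime] [Q.LiesOver p] :
    emultiplicity Q (differentIdeal A B) ≤ emultiplicity Q ((p ^ k).map (algebraMap A B)) := by
  by_contra! hlt
  have hpk : p ^ k ≠ ⊥ := pow_ne_zero _ hp
  refine hk (finrank_mem_of_map_dvd_differentIdeal hpk ?_)
  rw [UniqueFactorizationMonoid.dvd_iff_emultiplicity_le
    ((Ideal.map_eq_bot_iff_of_injective (FaithfulSMul.algebraMap_injective _ _)).not.2 hpk)]
  intro P hP
  have := Ideal.isPrime_of_prime hP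
  by_cases hPp : P ∣ (p ^ k).map (algebraMap A B)
  · have hPle : p ≤ P.under A := by
      rw [Ideal.dvd_iff_le, Ideal.map_pow] at hPp
      exact Ideal.map_le_iff_le_comap.1 (Ideal.IsPrime.le_of_pow_le hPp)
    have : p.IsMaximal := Ideal.IsPrime.isMaximal ‹_› hp
    have : P.LiesOver p := ⟨this.eq_of_le (Ideal.IsPrime.under A P).ne_top hPle⟩
    rw [emultiplicity_eq_of_smul_eq p (Q := Q) fun σ : G ↦ smul_differentIdeal σ,
      emultiplicity_eq_of_smul_eq p (Q := Q) fun σ : G ↦ smul_map_algebraMap σ _]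
    exact hlt.le
  · rw [emultiplicity_eq_zero.2 hPp]
    exact zero_le

theorem differentIdeal_dvd_map_prod (G : Type*) [Group G] [Finite G] [MulSemiringAction G B]
    [IsGaloisGroup G A B] {S : Finset (HeightOneSpectrum A)} {k : HeightOneSpectrum A → ℕ}
    (hk : ∀ v ∈ S, (Module.finrank A B : A) ∉ v.asIdeal ^ k v)
    (h : ∀ v ∉ S, Algebra.IsUnramifiedIn B v.asIdeal) :
    differentIdeal A B ∣ (∏ v ∈ S, v.asIdeal ^ k v).map (algebraMap A B) := by
  have hD : differentIdeal A B ≠ ⊥ := differentIdeal_ne_bot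
  rw [UniqueFactorizationMonoid.dvd_iff_emultiplicity_le hD]
  intro Q hQ
  have hQprime := Ideal.isPrime_of_prime hQ
  let v : HeightOneSpectrum A := HeightOneSpectrum.under A ⟨Q, hQprime, hQ.ne_zero⟩
  have hQv : Q.LiesOver v.asIdeal := ⟨rfl⟩
  by_cases hv : v ∈ S
  · refine (emultiplicity_differentIdeal_le G v.ne_bot (hk v hv) Q).trans
      (emultiplicity_le_emultiplicity_of_dvd_right ?_)
    exact map_dvd (Ideal.mapHom (algebraMap A B))
      (Finset.dvd_prod_of_mem (fun v ↦ v.asIdeal ^ k v) hv)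
  · rw [emultiplicity_eq_zero.2 (not_dvd_differentIdeal_iff.2 (h v hv Q hQprime hQv))]
    exact zero_le

end Different

section HermiteMinkowski

open scoped Nat

variable {K : Type*} [Field K] [NumberField K] {T : Set (NFPlace K)}

theorem exists_natAbs_discr_le (hT : T.Finite) (n : ℕ) :
    ∃ b : ℕ, ∀ (L : Type*) [Field L] [NumberField L] [Algebra K L] [IsGalois K L],
      Module.finrank K L ≤ n → UnramifiedOutside K L T → (discr L).natAbs ≤ b := by
  have hn : (n ! : 𝓞 K) ≠ 0 := Nat.cast_ne_zero.2 n.factorial_ne_zero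
  choose k hk using fun v : HeightOneSpectrum (𝓞 K) ↦ exists_notMem_pow v.isPrime.ne_top hn
  let S : Finset (HeightOneSpectrum (𝓞 K)) := (hT.preimage Sum.inl_injective.injOn).toFinset
  let J : Ideal (𝓞 K) := ∏ v ∈ S, v.asIdeal ^ k v
  have hJ : Ideal.absNorm J ≠ 0 :=
    Ideal.absNorm_eq_zero_iff.not.2 (Finset.prod_ne_zero_iff.2 fun v _ ↦ pow_ne_zero _ v.ne_bot)
  refine ⟨(Ideal.absNorm J * (discr K).natAbs) ^ n, fun L _ _ _ _ hL h ↦ ?_⟩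
  have hfin : Module.finrank (𝓞 K) (𝓞 L) = Module.finrank K L :=
    (IsFractionRing.finrank_eq (𝓞 K) K (𝓞 L) L).symm
  have hkL : ∀ v ∈ S, (Module.finrank (𝓞 K) (𝓞 L) : 𝓞 K) ∉ v.asIdeal ^ k v := fun v _ hv ↦
    hk v (Ideal.mem_of_dvd _
      (Nat.cast_dvd_cast (Nat.dvd_factorial (hfin ▸ Module.finrank_pos) (hfin ▸ hL))) hv)
  have hD : differentIdeal (𝓞 K) (𝓞 L) ∣ J.map (algebraMap (𝓞 K) (𝓞 L)) :=
    differentIdeal_dvd_map_prod Gal(L/K) hkL fun v hv ↦ h.1 v (by simpa [S] using hv)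
  have hDJ : (differentIdeal (𝓞 K) (𝓞 L)).absNorm ∣ J.absNorm ^ Module.finrank K L := by
    rw [← hfin, ← Ideal.absNorm_algebraMap]
    exact map_dvd Ideal.absNorm hD
  rw [natAbs_discr_eq_absNorm_differentIdeal_mul_natAbs_discr_pow K (𝓞 K) L (𝓞 L)]
  calc _ ≤ J.absNorm ^ Module.finrank K L * (discr K).natAbs ^ Module.finrank K L :=
        Nat.mul_le_mul_right _ (Nat.le_of_dvd (pow_pos (Nat.pos_of_ne_zero hJ) _) hDJ)
    _ = (J.absNorm * (discr K).natAbs) ^ Module.finrank K L := (mul_pow _ _ _).symm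
    _ ≤ (J.absNorm * (discr K).natAbs) ^ n :=
        Nat.pow_le_pow_right (Nat.pos_of_ne_zero
          (mul_ne_zero hJ (Int.natAbs_ne_zero.2 (discr_ne_zero K)))) hL

theorem finite_setOf_finrank_le (Ω : Type*) [Field Ω] [Algebra K Ω] (hT : T.Finite) (n : ℕ) :
    {F : IntermediateField K Ω | FiniteDimensional K F ∧ IsGalois K F ∧
      Module.finrank K F ≤ n ∧ UnramifiedOutside K F T}.Finite := by
  have : CharZero Ω := charZero_of_injective_algebraMap (algebraMap K Ω).injective
  obtain ⟨b, hb⟩ := exists_natAbs_discr_le hT n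
  have hfin := (NumberField.finite_of_discr_bdd Ω b).image Subtype.val
  refine Set.Finite.of_finite_image (f := fun F ↦ F.restrictScalars ℚ) (hfin.subset ?_)
    (IntermediateField.restrictScalars_injective ℚ).injOn
  rintro _ ⟨F, ⟨_, _, hF, h⟩, rfl⟩
  have : NumberField F := NumberField.of_module_finite K F
  have hfd : FiniteDimensional ℚ (F.restrictScalars ℚ) := inferInstanceAs (FiniteDimensional ℚ F)
  refine ⟨⟨F.restrictScalars ℚ, hfd⟩, ?_, rfl⟩
  have hF : (discr F).natAbs ≤ b := hb F hF h
  change |discr F| ≤ b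
  rw [Int.abs_eq_natAbs]
  exact_mod_cast hF

end HermiteMinkowski

section InflatedHom

variable {Γ H A A' : Type*} [Group Γ] [Group H] [Group A] [Group A']

theorem monoidHom_ker_le_ker_comp (f : A →* A') (φ : Γ →* A) : φ.ker ≤ (f.comp φ).ker := by
  rw [← MonoidHom.comap_ker, ← MonoidHom.comap_bot]
  exact Subgroup.comap_mono bot_le

theorem finite_setOf_le_ker [Finite A] (N : Subgroup Γ) [N.FiniteIndex] :
    {φ : Γ →* A | N ≤ φ.ker}.Finite := by
  have : Finite (Γ ⧸ N.normalCore →* A) := .of_injective _ DFunLike.coe_injective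
  refine (Set.finite_range fun ψ : Γ ⧸ N.normalCore →* A ↦
    ψ.comp (QuotientGroup.mk' _)).subset fun φ hφ ↦ ?_
  exact ⟨QuotientGroup.lift _ φ (N.normalCore_le.trans hφ), QuotientGroup.lift_comp_mk' _ φ _⟩

variable [TopologicalSpace Γ] [TopologicalSpace H]

/-- The homomorphisms from `Γ` to `A` with open kernel containing `N`. For `N` normal, these are
the inflations to `Γ` of the continuous homomorphisms from `Γ ⧸ N` to the discrete group `A`;
working on `Γ` makes it possible to compare different subgroups `N`. -/
def inflatedHom (N : Subgroup Γ) (A : Type*) [Group A] : Set (Γ →* A) :=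
  {φ | IsOpen (φ.ker : Set Γ) ∧ N ≤ φ.ker}

variable {N : Subgroup Γ}

theorem one_mem_inflatedHom : (1 : Γ →* A) ∈ inflatedHom N A := by
  simp [inflatedHom]

theorem ncard_inflatedHom_le_one [Subsingleton A] : (inflatedHom N A).ncard ≤ 1 := by
  have : Subsingleton (Γ →* A) := ⟨fun _ _ ↦ MonoidHom.ext fun _ ↦ Subsingleton.elim _ _⟩
  exact Set.ncard_le_one_of_subsingleton _

/-- Inflation along a topological quotient map. -/
noncomputable def discreteHomEquivInflatedHom [IsTopologicalGroup H] {q : Γ →* H}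
    (hq : Topology.IsQuotientMap q) (hker : q.ker = N) : DiscreteHom H A ≃ inflatedHom N A :=
  letI : TopologicalSpace A := ⊥
  haveI : DiscreteTopology A := ⟨rfl⟩
  Equiv.ofBijective
    (fun f ↦ ⟨f.toMonoidHom.comp q,
      (isOpen_discrete {1}).preimage (f.continuous_toFun.comp hq.continuous),
      hker.ge.trans (monoidHom_ker_le_ker_comp f.toMonoidHom q)⟩) <| by
    refine ⟨fun f g h ↦ ?_, fun ⟨φ, hφ, hle⟩ ↦ ?_⟩
    · ext x
      obtain ⟨γ, rfl⟩ := hq.surjective x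
      exact DFunLike.congr_fun (congrArg Subtype.val h) γ
    · let f : H →* A := q.liftOfSurjective hq.surjective ⟨φ, hker.le.trans hle⟩
      have hf : f.comp q = φ := q.liftOfRightInverse_comp _ _ ⟨φ, hker.le.trans hle⟩
      have hopen : IsOpen (f.ker : Set H) := by
        rw [← hq.isOpen_preimage]
        rwa [← hf] at hφ
      have hcont : Continuous f := by
        refine continuous_of_continuousAt_one f ?_
        rw [ContinuousAt, map_one, nhds_discrete A, Filter.tendsto_pure]
        exact hopen.mem_nhds (one_mem f.ker)
      exact ⟨⟨f, hcont⟩, Subtype.ext hf⟩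

variable [ContinuousMul Γ]

theorem comp_mem_inflatedHom {φ : Γ →* A} (hφ : φ ∈ inflatedHom N A) (f : A →* A') :
    f.comp φ ∈ inflatedHom N A' :=
  have hker := monoidHom_ker_le_ker_comp f φ
  ⟨Subgroup.isOpen_mono hker hφ.1, hφ.2.trans hker⟩

theorem ncard_inflatedHom_le_of_injective {f : A →* A'} (hf : Function.Injective f)
    (hfin : (inflatedHom N A').Finite) : (inflatedHom N A).ncard ≤ (inflatedHom N A').ncard :=
  Set.ncard_le_ncard_of_injOn f.comp (fun _ hφ ↦ comp_mem_inflatedHom hφ f)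
    (fun _ _ _ _ ↦ (MonoidHom.cancel_left hf).1) hfin

end InflatedHom

section Counting

open scoped Finset

theorem exists_ncard_le_ncard_fibre_mul {α β : Type*} {f : α → β} {s : Set α} {t : Set β}
    (hs : s.Finite) (hne : s.Nonempty) (ht : t.Finite) (hf : Set.MapsTo f s t) :
    ∃ x₀ ∈ s, s.ncard ≤ {x ∈ s | f x = f x₀}.ncard * t.ncard := by
  classical
  lift s to Finset α using hs
  lift t to Finset β using ht
  obtain ⟨x₀, hx₀, hmax⟩ := s.exists_max_image (fun x ↦ #{y ∈ s | f y = f x}) hne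
  refine ⟨x₀, hx₀, ?_⟩
  simp only [← Finset.coe_filter, Set.ncard_coe_finset, Finset.mem_coe]
  refine Finset.card_le_mul_card_image_of_maps_to hf _ fun b _ ↦ ?_
  obtain h | ⟨x, hx⟩ := ({y ∈ s | f y = b}).eq_empty_or_nonempty
  · simp [h]
  · obtain ⟨hxs, rfl⟩ := Finset.mem_filter.1 hx
    exact hmax x hxs

theorem pow_sub_one_le_pow {g b : ℕ} (hg : 1 ≤ g) (hgb : g ≤ b) : b ^ (g - 1) ≤ g ^ b := by
  obtain ⟨t, rfl⟩ := Nat.exists_eq_add_of_le' hg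
  rw [Nat.add_sub_cancel]
  obtain rfl | ht := Nat.eq_zero_or_pos t
  · simp
  have ht' : (0 : ℝ) < t := by exact_mod_cast ht
  have hp : (1 : ℝ) ≤ b / t := by
    rw [one_le_div ht']
    exact_mod_cast (Nat.le_succ t).trans hgb
  have bernoulli : (b : ℝ) ≤ (t + 1) ^ ((b : ℝ) / t) := by
    have h := one_add_mul_self_le_rpow_one_add (s := (t : ℝ)) (by linarith) hp
    rw [div_mul_cancel₀ _ ht'.ne', add_comm (1 : ℝ) t] at h
    linarith
  have : (b : ℝ) ^ t ≤ (t + 1) ^ b :=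
    calc (b : ℝ) ^ t ≤ ((t + 1) ^ ((b : ℝ) / t)) ^ t := by gcongr
      _ = (t + 1) ^ b := by
        rw [← Real.rpow_mul_natCast (by positivity), div_mul_cancel₀ _ ht'.ne', Real.rpow_natCast]
  exact_mod_cast this

variable {Γ M B : Type*} [Group Γ] [Group M] [Group B] {A : Subgroup B} {φ₀ : Γ →* B}

theorem exists_monoidHom_eq_mul_inv {φ φ₀ : M →* B} (h : ∀ x, φ x * (φ₀ x)⁻¹ ∈ A)
    (h₀ : ∀ x, φ₀ x ∈ Subgroup.centralizer (A : Set B)) :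
    ∃ ψ : M →* A, ∀ x, (ψ x : B) = φ x * (φ₀ x)⁻¹ := by
  refine ⟨MonoidHom.mk' (fun x ↦ ⟨φ x * (φ₀ x)⁻¹, h x⟩) fun x y ↦ Subtype.ext ?_, fun _ ↦ rfl⟩
  have hcomm : φ y * (φ₀ y)⁻¹ * (φ₀ x)⁻¹ = (φ₀ x)⁻¹ * (φ y * (φ₀ y)⁻¹) :=
    Subgroup.mem_centralizer_iff.1 (inv_mem (h₀ x)) _ (h y)
  calc φ (x * y) * (φ₀ (x * y))⁻¹ = φ x * (φ y * (φ₀ y)⁻¹ * (φ₀ x)⁻¹) := by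
        simp only [map_mul, mul_inv_rev, mul_assoc]
    _ = φ x * (φ₀ x)⁻¹ * (φ y * (φ₀ y)⁻¹) := by rw [hcomm, mul_assoc]

-- `φ` is determined by `φ ∘ ι` and its values at representatives of the nontrivial cosets.
theorem ncard_le_card_pow_mul_ncard_image_comp [Finite A] (ι : M →* Γ) [ι.range.FiniteIndex]
    {X : Set (Γ →* B)} (hX : ∀ φ ∈ X, ∀ γ, φ γ * (φ₀ γ)⁻¹ ∈ A)
    (hfin : ((fun φ ↦ φ.comp ι) '' X).Finite) :
    X.ncard ≤ Nat.card A ^ (ι.range.index - 1) * ((fun φ ↦ φ.comp ι) '' X).ncard := by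
  have := hfin.to_subtype
  have : Finite (Γ ⧸ ι.range) := Subgroup.finite_quotient_of_finiteIndex
  let Q := {q : Γ ⧸ ι.range // q ≠ (1 : Γ)}
  have hQ : Nat.card Q = ι.range.index - 1 := by
    classical
    have := Fintype.ofFinite (Γ ⧸ ι.range)
    rw [Subgroup.index, Nat.card_eq_fintype_card, Nat.card_eq_fintype_card]
    exact Set.card_ne_eq _
  let F (φ : X) : (Q → A) × ((fun φ ↦ φ.comp ι) '' X) :=
    (fun q ↦ ⟨φ.1 q.1.out * (φ₀ q.1.out)⁻¹, hX _ φ.2 _⟩, ⟨_, φ, φ.2, rfl⟩)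
  have hF : Function.Injective F := by
    intro φ φ' h
    obtain ⟨hrep, hres⟩ := Prod.ext_iff.1 h
    have hrep (q : Q) : φ.1 q.1.out = φ'.1 q.1.out :=
      mul_right_cancel (congrArg Subtype.val (congrFun hrep q))
    have hres (x : M) : φ.1 (ι x) = φ'.1 (ι x) := DFunLike.congr_fun (congrArg Subtype.val hres) x
    ext γ
    by_cases hγ : (γ : Γ ⧸ ι.range) = (1 : Γ)
    · obtain ⟨x, rfl⟩ : γ ∈ ι.range := by simpa using QuotientGroup.eq.1 hγ.symm
      exact hres x
    · obtain ⟨⟨_, x, rfl⟩, hx⟩ := QuotientGroup.mk_out_eq_mul ι.range γ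
      have : γ = (γ : Γ ⧸ ι.range).out * ι x⁻¹ := by simp [hx]
      rw [this, map_mul, map_mul, hrep ⟨γ, hγ⟩, hres]
  calc X.ncard ≤ Nat.card ((Q → A) × ((fun φ ↦ φ.comp ι) '' X)) :=
        Nat.card_le_card_of_injective F hF
    _ = _ := by rw [Nat.card_prod, Nat.card_fun, hQ, Nat.card_coe_set_eq]

variable [TopologicalSpace Γ] {N : Subgroup Γ}

/-- The members of `inflatedHom N B` that agree with `φ₀` modulo the subgroup `A`. -/
def inflatedHomFibre (N : Subgroup Γ) (A : Subgroup B) (φ₀ : Γ →* B) : Set (Γ →* B) :=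
  {φ ∈ inflatedHom N B | ∀ γ, φ γ * (φ₀ γ)⁻¹ ∈ A}

theorem exists_ncard_inflatedHom_le [ContinuousMul Γ] (A : Subgroup B) [A.Normal]
    (hfin : (inflatedHom N B).Finite) (hfin' : (inflatedHom N (B ⧸ A)).Finite) :
    ∃ φ₀ ∈ inflatedHom N B, (A = ⊤ → φ₀ = 1) ∧
      (inflatedHom N B).ncard ≤
        (inflatedHomFibre N A φ₀).ncard * (inflatedHom N (B ⧸ A)).ncard := by
  by_cases hA : A = ⊤
  · refine ⟨1, one_mem_inflatedHom, fun _ ↦ rfl, ?_⟩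
    have : inflatedHomFibre N A 1 = inflatedHom N B := by simp [inflatedHomFibre, hA]
    rw [this]
    exact Nat.le_mul_of_pos_right _ ((Set.ncard_pos hfin').2 ⟨1, one_mem_inflatedHom⟩)
  · obtain ⟨φ₀, h₀, hle⟩ := exists_ncard_le_ncard_fibre_mul hfin ⟨1, one_mem_inflatedHom⟩ hfin'
      (fun φ hφ ↦ comp_mem_inflatedHom hφ (QuotientGroup.mk' A))
    refine ⟨φ₀, h₀, fun h ↦ (hA h).elim, ?_⟩
    simpa [inflatedHomFibre, DFunLike.ext_iff, QuotientGroup.eq_iff_div_mem, div_eq_mul_inv]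
      using hle

variable [TopologicalSpace M] [ContinuousMul M] {N' : Subgroup M}

theorem ncard_inflatedHomFibre_le [Finite A] (h₀ : φ₀ ∈ inflatedHom N B) {ι : M →* Γ}
    [ι.range.FiniteIndex] (hι : Continuous ι) (hN : N'.map ι ≤ N)
    (hcent : ∀ x, φ₀ (ι x) ∈ Subgroup.centralizer (A : Set B)) (hfin : (inflatedHom N' A).Finite) :
    (inflatedHomFibre N A φ₀).ncard ≤
      Nat.card A ^ (ι.range.index - 1) * (inflatedHom N' A).ncard := by
  set X := inflatedHomFibre N A φ₀
  have hψ : ∀ χ ∈ (fun φ : Γ →* B ↦ φ.comp ι) '' X,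
      ∃ ψ ∈ inflatedHom N' A, ∀ x, (ψ x : B) = χ x * (φ₀ (ι x))⁻¹ := by
    rintro _ ⟨φ, ⟨hφ, hA⟩, rfl⟩
    obtain ⟨ψ, hψ⟩ :=
      exists_monoidHom_eq_mul_inv (φ := φ.comp ι) (φ₀ := φ₀.comp ι) (fun x ↦ hA (ι x)) hcent
    have hle : (φ.ker ⊓ φ₀.ker).comap ι ≤ ψ.ker := fun x ⟨hx, hx₀⟩ ↦ by
      rw [MonoidHom.mem_ker, ← OneMemClass.coe_eq_one, hψ]
      simp [MonoidHom.mem_ker.1 hx, MonoidHom.mem_ker.1 hx₀]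
    exact ⟨ψ, ⟨Subgroup.isOpen_mono hle ((hφ.1.inter h₀.1).preimage hι),
      (Subgroup.map_le_iff_le_comap.1 (hN.trans (le_inf hφ.2 h₀.2))).trans hle⟩, hψ⟩
  choose! ψ hmem hval using hψ
  have hinj : Set.InjOn ψ ((fun φ : Γ →* B ↦ φ.comp ι) '' X) := by
    intro χ hχ χ' hχ' h
    ext x
    exact mul_right_cancel (b := (φ₀ (ι x))⁻¹) (by rw [← hval χ hχ, ← hval χ' hχ', h])
  refine (ncard_le_card_pow_mul_ncard_image_comp ι (fun φ hφ ↦ hφ.2)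
    (hfin.of_injOn hmem hinj)).trans (Nat.mul_le_mul_left _ ?_)
  exact Set.ncard_le_ncard_of_injOn ψ hmem hinj hfin

end Counting

section Krull

variable {K Ω : Type*} [Field K] [Field Ω] [Algebra K Ω] {L : IntermediateField K Ω}

theorem range_restrictScalarsHom :
    (AlgEquiv.restrictScalarsHom K : Gal(Ω/L) →* Gal(Ω/K)).range = L.fixingSubgroup := by
  ext σ
  rw [IntermediateField.mem_fixingSubgroup_iff]
  constructor
  · rintro ⟨τ, rfl⟩ x hx
    exact τ.commutes ⟨x, hx⟩
  · intro h
    exact ⟨AlgEquiv.ofRingEquiv (f := σ.toRingEquiv) fun x ↦ h x x.2, rfl⟩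

theorem map_restrictScalarsHom_fixingSubgroup_le {U : IntermediateField K Ω}
    {U' : IntermediateField L Ω} (h : U ≤ U'.restrictScalars K) :
    U'.fixingSubgroup.map (AlgEquiv.restrictScalarsHom K) ≤ U.fixingSubgroup := by
  rintro _ ⟨τ, hτ, rfl⟩
  rw [IntermediateField.mem_fixingSubgroup_iff]
  exact fun x hx ↦ (IntermediateField.mem_fixingSubgroup_iff _ _).1 hτ x (h hx)

theorem continuous_restrictScalarsHom [Algebra.IsIntegral K Ω] :
    Continuous (AlgEquiv.restrictScalarsHom K : Gal(Ω/L) →* Gal(Ω/K)) := by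
  refine continuous_of_continuousAt_one _ (continuousAt_def.2 fun s hs ↦ ?_)
  rw [map_one, krullTopology_mem_nhds_one_iff] at hs
  obtain ⟨E, _, hE⟩ := hs
  obtain ⟨S, rfl⟩ : E.FG := IntermediateField.essFiniteType_iff.1 inferInstance
  have : FiniteDimensional L (IntermediateField.adjoin L (S : Set Ω)) :=
    IntermediateField.finiteDimensional_adjoin fun x _ ↦
      (Algebra.IsIntegral.isIntegral (R := K) x).tower_top
  rw [krullTopology_mem_nhds_one_iff]
  refine ⟨_, this, fun τ hτ ↦ hE (map_restrictScalarsHom_fixingSubgroup_le ?_ ⟨τ, hτ, rfl⟩)⟩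
  exact IntermediateField.adjoin_le_iff.2 (IntermediateField.subset_adjoin L (S : Set Ω))

variable [IsGalois K Ω]

theorem isQuotientMap_restrictNormalHom (U : IntermediateField K Ω) [Normal K U] :
    Topology.IsQuotientMap (AlgEquiv.restrictNormalHom U : Gal(Ω/K) →* Gal(U/K)) :=
  (InfiniteGalois.restrictNormalHom_continuous U).isClosedMap.isQuotientMap
    (InfiniteGalois.restrictNormalHom_continuous U) (AlgEquiv.restrictNormalHom_surjective Ω)

variable {B : Type*} [Group B] {φ : Gal(Ω/K) →* B}

theorem fixingSubgroup_fixedField_ker (hφ : IsOpen (φ.ker : Set Gal(Ω/K))) :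
    (IntermediateField.fixedField φ.ker).fixingSubgroup = φ.ker :=
  InfiniteGalois.fixingSubgroup_fixedField ⟨φ.ker, Subgroup.isClosed_of_isOpen _ hφ⟩

theorem finiteDimensional_and_isGalois_fixedField_ker (hφ : IsOpen (φ.ker : Set Gal(Ω/K))) :
    FiniteDimensional K (IntermediateField.fixedField φ.ker) ∧
      IsGalois K (IntermediateField.fixedField φ.ker) := by
  rw [← InfiniteGalois.isOpen_and_normal_iff_finite_and_isGalois,
    fixingSubgroup_fixedField_ker hφ]
  exact ⟨hφ, inferInstance⟩

theorem exists_injective_gal_fixedField_ker (hφ : IsOpen (φ.ker : Set Gal(Ω/K))) :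
    ∃ ψ : Gal(IntermediateField.fixedField φ.ker/K) →* B, Function.Injective ψ := by
  let C : ClosedSubgroup Gal(Ω/K) := ⟨φ.ker, Subgroup.isClosed_of_isOpen _ hφ⟩
  have : C.Normal := inferInstanceAs φ.ker.Normal
  exact ⟨(QuotientGroup.kerLift φ).comp (InfiniteGalois.normalAutEquivQuotient C).symm.toMonoidHom,
    (QuotientGroup.kerLift_injective φ).comp (MulEquiv.injective _)⟩

theorem fixedField_ker_le {U : IntermediateField K Ω} (hU : U.fixingSubgroup ≤ φ.ker) :
    IntermediateField.fixedField φ.ker ≤ U := by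
  rw [← InfiniteGalois.fixedField_fixingSubgroup U]
  exact IntermediateField.fixedField_antitone hU

end Krull

section UnramifiedHom

variable {K Ω : Type*} [Field K] [NumberField K] [Field Ω] [Algebra K Ω] [IsGalois K Ω]
  {T : Set (NFPlace K)} {A : Type*} [Group A]

variable (K Ω T A) in
/-- The homomorphisms from `Gal(Ω/K)` to `A` that factor through a continuous homomorphism from
`G_K^T` to the discrete group `A`. -/
abbrev unramifiedHom : Set (Gal(Ω/K) →* A) :=
  inflatedHom (maxUnramifiedOutside K Ω T).fixingSubgroup A

variable (K Ω T A) in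
/-- Inflation identifies the continuous homomorphisms from `G_K^T` with `unramifiedHom K Ω T A`. -/
noncomputable def discreteHomEquivUnramifiedHom :
    DiscreteHom (GaloisGroupOutside K Ω T) A ≃ unramifiedHom K Ω T A :=
  discreteHomEquivInflatedHom (isQuotientMap_restrictNormalHom _)
    (IntermediateField.restrictNormalHom_ker _)

theorem card_discreteHom_eq_ncard_unramifiedHom :
    Nat.card (DiscreteHom (GaloisGroupOutside K Ω T) A) = (unramifiedHom K Ω T A).ncard := by
  rw [Nat.card_congr (discreteHomEquivUnramifiedHom K Ω T A), Nat.card_coe_set_eq]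

theorem unramifiedOutside_fixedField_ker {φ : Gal(Ω/K) →* A} (hφ : φ ∈ unramifiedHom K Ω T A) :
    UnramifiedOutside K (IntermediateField.fixedField φ.ker) T := by
  obtain ⟨_, _⟩ := finiteDimensional_and_isGalois_fixedField_ker hφ.1
  exact le_maxUnramifiedOutside_iff.1 (fixedField_ker_le hφ.2)

theorem finite_unramifiedHom [Finite A] (hT : T.Finite) : (unramifiedHom K Ω T A).Finite := by
  let 𝓕 := {F : IntermediateField K Ω | FiniteDimensional K F ∧ IsGalois K F ∧
    Module.finrank K F ≤ Nat.card A ∧ UnramifiedOutside K F T}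
  have : Finite 𝓕 := finite_setOf_finrank_le Ω hT (Nat.card A)
  have (F : 𝓕) : FiniteDimensional K F.1 := F.2.1
  let M : IntermediateField K Ω := ⨆ F : 𝓕, F.1
  have : M.fixingSubgroup.FiniteIndex := ⟨by
    rw [← IntermediateField.finrank_eq_fixingSubgroup_index]
    exact Module.finrank_pos.ne'⟩
  refine (finite_setOf_le_ker M.fixingSubgroup).subset fun φ hφ ↦ ?_
  obtain ⟨hfin, hgal⟩ := finiteDimensional_and_isGalois_fixedField_ker hφ.1
  have hcard : Module.finrank K (IntermediateField.fixedField φ.ker) ≤ Nat.card A := by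
    rw [IntermediateField.finrank_eq_fixingSubgroup_index, fixingSubgroup_fixedField_ker hφ.1,
      Subgroup.index_ker]
    exact Nat.card_le_card_of_injective _ Subtype.val_injective
  have hle : IntermediateField.fixedField φ.ker ≤ M :=
    le_iSup (fun F : 𝓕 ↦ F.1) ⟨_, hfin, hgal, hcard, unramifiedOutside_fixedField_ker hφ⟩
  rw [Set.mem_ofPred_eq, ← fixingSubgroup_fixedField_ker hφ.1]
  exact IntermediateField.fixingSubgroup_antitone hle

theorem finite_discreteHom_galoisGroupOutside [Finite A] (hT : T.Finite) :
    Finite (DiscreteHom (GaloisGroupOutside K Ω T) A) := by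
  have : Finite (unramifiedHom K Ω T A) := finite_unramifiedHom hT
  exact .of_equiv _ (discreteHomEquivUnramifiedHom K Ω T A).symm

theorem le_maxUnramifiedOutside_placesAbove {L : IntermediateField K Ω} [FiniteDimensional K L]
    {E : IntermediateField L Ω} [FiniteDimensional L E] (hE : UnramifiedOutside K E T) :
    E ≤ maxUnramifiedOutside L Ω (placesAbove T L) :=
  have := NumberField.of_module_finite K L
  le_maxUnramifiedOutside_iff.2 (hE.tower_top L)

theorem maxUnramifiedOutside_le_restrictScalars {L : IntermediateField K Ω} [FiniteDimensional K L]
    (hL : UnramifiedOutside K L T) :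
    maxUnramifiedOutside K Ω T ≤
      (maxUnramifiedOutside L Ω (placesAbove T L)).restrictScalars K := by
  refine sSup_le fun F ⟨_, hF⟩ ↦ le_sup_right.trans (b := L ⊔ F) ?_
  have : FiniteDimensional K (IntermediateField.extendScalars (le_sup_left : L ≤ L ⊔ F)) :=
    inferInstanceAs (FiniteDimensional K ↥(L ⊔ F))
  have : FiniteDimensional L (IntermediateField.extendScalars (le_sup_left : L ≤ L ⊔ F)) :=
    .right K L _
  have hE : UnramifiedOutside K (IntermediateField.extendScalars (le_sup_left : L ≤ L ⊔ F)) T :=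
    hL.sup hF
  exact le_maxUnramifiedOutside_placesAbove hE

end UnramifiedHom

section NormalSubgroupStep

variable {K Ω : Type*} [Field K] [NumberField K] [Field Ω] [Algebra K Ω] [IsGalois K Ω]
  {T : Set (NFPlace K)} {B : Type*} [Group B] [Finite B] {A : Subgroup B}

theorem ncard_fibre_unramifiedHom_le (hT : T.Finite) {φ₀ : Gal(Ω/K) →* B}
    (h₀ : φ₀ ∈ unramifiedHom K Ω T B) {L : IntermediateField K Ω} [FiniteDimensional K L]
    (hL : UnramifiedOutside K L T)
    (hcent : ∀ σ ∈ L.fixingSubgroup, φ₀ σ ∈ Subgroup.centralizer (A : Set B))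
    (hcard : Module.finrank K L ≤ Nat.card B) :
    (inflatedHomFibre (maxUnramifiedOutside K Ω T).fixingSubgroup A φ₀).ncard ≤
      Module.finrank K L ^ Nat.card B * (unramifiedHom L Ω (placesAbove T L) A).ncard := by
  have := NumberField.of_module_finite K L
  let ι : Gal(Ω/L) →* Gal(Ω/K) := AlgEquiv.restrictScalarsHom K
  have hι (τ : Gal(Ω/L)) : ι τ ∈ L.fixingSubgroup := range_restrictScalarsHom (L := L) ▸ ⟨τ, rfl⟩
  have hindex : ι.range.index = Module.finrank K L := by
    rw [range_restrictScalarsHom, IntermediateField.finrank_eq_fixingSubgroup_index]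
  have : ι.range.FiniteIndex := ⟨hindex ▸ Module.finrank_pos.ne'⟩
  calc (inflatedHomFibre (maxUnramifiedOutside K Ω T).fixingSubgroup A φ₀).ncard
      ≤ Nat.card A ^ (ι.range.index - 1) * (unramifiedHom L Ω (placesAbove T L) A).ncard :=
        ncard_inflatedHomFibre_le h₀ continuous_restrictScalarsHom
          (map_restrictScalarsHom_fixingSubgroup_le (maxUnramifiedOutside_le_restrictScalars hL))
          (fun τ ↦ hcent _ (hι τ)) (finite_unramifiedHom (NFPlace.finite_placesAbove hT))
    _ ≤ Nat.card B ^ (Module.finrank K L - 1) *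
          (unramifiedHom L Ω (placesAbove T L) A).ncard := by
        rw [hindex]
        gcongr
        exact Subgroup.card_le_card_group A
    _ ≤ _ := Nat.mul_le_mul_right _ (pow_sub_one_le_pow Module.finrank_pos hcard)

variable (A) in
theorem exists_ncard_unramifiedHom_le_of_normal [A.Normal] (hT : T.Finite) :
    ∃ L : IntermediateField K Ω,
      (FiniteDimensional K L ∧ IsGalois K L ∧ UnramifiedOutside K L T) ∧ (A = ⊤ → L = ⊥) ∧
      (∃ ψ : Gal(L/K) →* B ⧸ Subgroup.centralizer (A : Set B), Function.Injective ψ) ∧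
      (unramifiedHom K Ω T B).ncard ≤
        Nat.card Gal(L/K) ^ Nat.card B * (unramifiedHom L Ω (placesAbove T L) A).ncard *
          (unramifiedHom K Ω T (B ⧸ A)).ncard := by
  obtain ⟨φ₀, h₀, htop, hle⟩ := exists_ncard_inflatedHom_le A
    (finite_unramifiedHom (K := K) (Ω := Ω) hT) (finite_unramifiedHom hT)
  -- `χ` is the action of `φ₀` on `A` by conjugation.
  let χ := (QuotientGroup.mk' (Subgroup.centralizer (A : Set B))).comp φ₀
  have hχ : χ ∈ unramifiedHom K Ω T _ := comp_mem_inflatedHom h₀ _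
  let L := IntermediateField.fixedField χ.ker
  obtain ⟨_, _⟩ := finiteDimensional_and_isGalois_fixedField_ker hχ.1
  obtain ⟨ψ, hψ⟩ := exists_injective_gal_fixedField_ker hχ.1
  have hunr : UnramifiedOutside K L T := unramifiedOutside_fixedField_ker hχ
  have hcent : ∀ σ ∈ L.fixingSubgroup, φ₀ σ ∈ Subgroup.centralizer (A : Set B) := by
    rw [fixingSubgroup_fixedField_ker hχ.1]
    exact fun σ hσ ↦ (QuotientGroup.eq_one_iff _).1 hσ
  have hcard : Nat.card Gal(L/K) ≤ Nat.card B :=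
    (Nat.card_le_card_of_injective ψ hψ).trans
      (Nat.card_le_card_of_surjective _ (QuotientGroup.mk'_surjective _))
  refine ⟨L, ⟨‹_›, ‹_›, hunr⟩, fun hA ↦ ?_, ⟨ψ, hψ⟩, ?_⟩
  · have : χ = 1 := by simp only [χ, htop hA, MonoidHom.comp_one]
    simp only [L, this, MonoidHom.ker_one]
    exact InfiniteGalois.fixedField_bot
  · rw [IsGalois.card_aut_eq_finrank] at hcard ⊢
    exact hle.trans (Nat.mul_le_mul_right _ (ncard_fibre_unramifiedHom_le hT h₀ hunr hcent hcard))

end NormalSubgroupStep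

section NormalSeriesCount

theorem le_prod_mul_last {m : ℕ} (h : Fin (m + 1) → ℕ) (c : Fin m → ℕ)
    (hc : ∀ i, h i.castSucc ≤ c i * h i.succ) : h 0 ≤ (∏ i, c i) * h (Fin.last m) := by
  induction m with
  | zero => simp
  | succ m ih =>
    rw [Fin.prod_univ_succ, mul_assoc]
    exact (hc 0).trans
      (Nat.mul_le_mul_left _ (ih (fun j ↦ h j.succ) (fun i ↦ c i.succ) fun i ↦ hc i.succ))

variable {K Ω : Type*} [Field K] [NumberField K] [Field Ω] [Algebra K Ω] [IsGalois K Ω]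
  {G : Type*} [Group G] {m : ℕ} (S : NormalSeries G m) {T : Set (NFPlace K)}

namespace NormalSeries

theorem factor_eq_top {i : Fin m} (hi : (i : ℕ) + 1 = m) : S.factor i = ⊤ := by
  have hlast : i.succ = Fin.last m := Fin.ext hi
  rw [factor, hlast, S.term_last]
  exact Subgroup.map_top_of_surjective _ (QuotientGroup.mk'_surjective _)

variable [Finite G]

theorem exists_ncard_unramifiedHom_le (hT : T.Finite) (i : Fin m) :
    ∃ L : IntermediateField K Ω,
      (FiniteDimensional K L ∧ IsGalois K L ∧ UnramifiedOutside K L T) ∧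
      ((i : ℕ) + 1 = m → L = ⊥) ∧ (∃ ψ : Gal(L/K) →* S.ActingQuot i, Function.Injective ψ) ∧
      (unramifiedHom K Ω T (S.Quot i)).ncard ≤
        Nat.card Gal(L/K) ^ Nat.card (S.Quot i) *
          Nat.card (DiscreteHom (GaloisGroupOutside L Ω (placesAbove T L)) (S.factor i)) *
        (unramifiedHom K Ω T (G ⧸ S.term i.succ)).ncard := by
  obtain ⟨L, ⟨_, hgal, hunr⟩, htop, hψ, hle⟩ :=
    exists_ncard_unramifiedHom_le_of_normal (K := K) (Ω := Ω) (S.factor i) hT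
  have := NumberField.of_module_finite K L
  let e : S.Quot i ⧸ S.factor i ≃* G ⧸ S.term i.succ :=
    QuotientGroup.quotientQuotientEquivQuotient _ _ (S.mono i.castSucc_le_succ)
  refine ⟨L, ⟨‹_›, hgal, hunr⟩, fun hi ↦ htop (S.factor_eq_top hi), hψ, hle.trans ?_⟩
  rw [card_discreteHom_eq_ncard_unramifiedHom]
  exact Nat.mul_le_mul_left _
    (ncard_inflatedHom_le_of_injective (f := e.toMonoidHom) e.injective (finite_unramifiedHom hT))

theorem card_discreteHom_le_ncard_unramifiedHom (hT : T.Finite) :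
    Nat.card (DiscreteHom (GaloisGroupOutside K Ω T) G) ≤
      (unramifiedHom K Ω T (G ⧸ S.term 0)).ncard := by
  rw [card_discreteHom_eq_ncard_unramifiedHom]
  refine ncard_inflatedHom_le_of_injective (f := QuotientGroup.mk' (S.term 0)) ?_
    (finite_unramifiedHom hT)
  rw [← MonoidHom.ker_eq_bot_iff, QuotientGroup.ker_mk', S.term_zero]

end NormalSeries

end NormalSeriesCount

theorem theorem4p2_general {K Ω : Type*} [Field K] [NumberField K] [Field Ω] [Algebra K Ω]
    [IsGalois K Ω] {G : Type*} [Group G] [Finite G] {m : ℕ} (S : NormalSeries G m)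
    (T : Set (NFPlace K)) (hT : T.Finite) :
    Finite (DiscreteHom (GaloisGroupOutside K Ω T) G) ∧
    ∃ L : Fin m → IntermediateField K Ω,
      (∀ i, FiniteDimensional K (L i) ∧ IsGalois K (L i) ∧ UnramifiedOutside K (L i) T) ∧
      (∀ i : Fin m, (i : ℕ) + 1 = m → L i = ⊥) ∧
      (∀ i, ∃ φ : Gal(L i/K) →* S.ActingQuot i, Function.Injective φ) ∧
      (∀ i, Finite (DiscreteHom (GaloisGroupOutside (L i) Ω (placesAbove T (L i)))
        (S.factor i))) ∧
      Nat.card (DiscreteHom (GaloisGroupOutside K Ω T) G) ≤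
        ∏ i : Fin m, Nat.card Gal(L i/K) ^ Nat.card (S.Quot i) *
          Nat.card (DiscreteHom (GaloisGroupOutside (L i) Ω (placesAbove T (L i)))
            (S.factor i)) := by
  choose L hL hbot hinj hle using S.exists_ncard_unramifiedHom_le (K := K) (Ω := Ω) hT
  refine ⟨finite_discreteHom_galoisGroupOutside hT, L, hL, hbot, hinj, fun i ↦ ?_, ?_⟩
  · have := (hL i).1
    have := NumberField.of_module_finite K (L i)
    exact finite_discreteHom_galoisGroupOutside (NFPlace.finite_placesAbove hT)
  · let h (j : Fin (m + 1)) : ℕ := (unramifiedHom K Ω T (G ⧸ S.term j)).ncard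
    have hlast : h (Fin.last m) ≤ 1 := by
      have : Subsingleton (G ⧸ S.term (Fin.last m)) := by
        rw [QuotientGroup.subsingleton_iff, S.term_last]
      exact ncard_inflatedHom_le_one
    exact (S.card_discreteHom_le_ncard_unramifiedHom hT).trans
      ((le_prod_mul_last h _ hle).trans (mul_le_of_le_one_right' hlast))

theorem theorem4p2 {K Ω : Type*} [Field K] [NumberField K] [Field Ω] [Algebra K Ω]
    [IsAlgClosure K Ω] {G : Type*} [Group G] [Finite G] {m : ℕ} (S : NormalSeries G m)
    (T : Set (NFPlace K)) (hT : T.Finite) :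
    Finite (DiscreteHom (GaloisGroupOutside K Ω T) G) ∧
    ∃ L : Fin m → IntermediateField K Ω,
      (∀ i, FiniteDimensional K (L i) ∧ IsGalois K (L i) ∧ UnramifiedOutside K (L i) T) ∧
      (∀ i : Fin m, (i : ℕ) + 1 = m → L i = ⊥) ∧
      (∀ i, ∃ φ : Gal(L i/K) →* S.ActingQuot i, Function.Injective φ) ∧
      (∀ i, Finite (DiscreteHom (GaloisGroupOutside (L i) Ω (placesAbove T (L i)))
        (S.factor i))) ∧
      Nat.card (DiscreteHom (GaloisGroupOutside K Ω T) G) ≤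
        ∏ i : Fin m, Nat.card Gal(L i/K) ^ Nat.card (S.Quot i) *
          Nat.card (DiscreteHom (GaloisGroupOutside (L i) Ω (placesAbove T (L i)))
            (S.factor i)) :=
  have : IsGalois K Ω := IsAlgClosure.isGalois K Ω
  theorem4p2_general S T hT
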